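/- A signed graph is a pair $\Gamma=(G,\sigma)$ of a simple graph $G$ and a sign function $\sigma:E(G)\to\{1,-1\}$. Its Laplacian matrix is $L(\Gamma)=D(G)-A(\Gamma)$, where $D(G)$ is the diagonal matrix of vertex degrees of $G$ and $A(\Gamma)$ has the entry $\sigma(xy)$ at adjacent vertices $x,y$ and $0$ elsewhere. Two signed graphs are Laplacian cospectral if their Laplacian matrices have the same eigenvalues with the same multiplicities, and isomorphic if there is an isomorphism of the underlying graphs that preserves the sign of every edge. If $\Gamma$ has vertex set $V_1\sqcup V_2$ with $V_1=\{u_1,\dots,u_n\}$ and $V_2=\{v_1,\dots,v_n\}$, its partial transpose $\Gamma^\tau$ is obtained by replacing every edge $(u_i,v_j)$ between $V_1$ and $V_2$ by the edge $(u_j,v_i)$ with the same sign, and keeping all edges inside $V_1$ and inside $V_2$. An overlined edge is negative, and an edge without overline is positive. **Theorem 3.1.** Let $n\ge 3$, and let $\Gamma$ be the signed graph on $V_1\sqcup V_2$ as above such that the signed subgraphs induced on $V_1$ and on $V_2$ are the paths $u_1u_2\cdots u_n$ and $v_1v_2\cdots v_n$ with all edges positive, and there are no edges between $V_1$ and $V_2$.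 Let $$\Gamma_1=\Gamma+\{(u_1,u_n),\ \overline{(u_1,v_1)},\ (u_1,v_n)\}.$$ Then: (i) $\Gamma_1$ and its partial transpose $\Gamma_1^\tau$ are non-isomorphic and Laplacian cospectral. (ii) The signed graphs $$\Gamma_2=\Gamma_1-\{(u_{n-1},u_n),\ \overline{(u_1,v_1)}\}+\{\overline{(u_{n-1},u_n)},\ (u_1,v_1)\},\qquad \Gamma_3=\Gamma_1^\tau-\{(u_{n-1},u_n)\}+\{\overline{(u_{n-1},u_n)}\}$$ are non-isomorphic and Laplacian cospectral. -/

import Mathlib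

/-- A signed graph: a simple graph together with a sign `+1` or `-1` on each of its edges. -/
structure SignedGraph (V : Type*) where
  graph : SimpleGraph V
  sign : graph.edgeSet → ℤˣ

namespace SignedGraph

variable {V W : Type*}

/-- Every edge is positive. -/
def AllPositive (Γ : SignedGraph V) : Prop := ∀ e, Γ.sign e = 1

/-- The signed graph induced on `W` along `f`. For injective `f` this is the induced signed
subgraph on the range of `f`, with its vertices labelled by `W`. -/
def comap (Γ : SignedGraph V) (f : W → V) : SignedGraph W where
  graph := Γ.graph.comap f
  sign e := Γ.sign ⟨e.1.map f, by
    obtain ⟨e, he⟩ := e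
    induction e with
    | _ x y => exact he⟩

/-- `Γ - S`: remove the edges belonging to `S`, keeping the signs of the other edges. -/
def removeEdges (Γ : SignedGraph V) (S : Set (Sym2 V)) : SignedGraph V where
  graph := Γ.graph.deleteEdges S
  sign e := Γ.sign ⟨e.1, SimpleGraph.edgeSet_mono (SimpleGraph.deleteEdges_le S) e.2⟩

open Classical in
/-- `Γ + {(a, b)}` where the new edge `(a, b)` gets the sign `ε`. It is meant for distinct
non-adjacent `a`, `b`; if `a` and `b` are already adjacent, the edge gets the sign `ε`. -/
noncomputable def addEdge (Γ : SignedGraph V) (a b : V) (ε : ℤˣ) : SignedGraph V where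
  graph := Γ.graph ⊔ SimpleGraph.edge a b
  sign e :=
    if h : e.1 ≠ s(a, b) then
      Γ.sign ⟨e.1, by
        obtain ⟨e, he⟩ := e
        rw [SimpleGraph.edgeSet_sup] at he
        rcases he with he | he
        · exact he
        · rw [SimpleGraph.edge, SimpleGraph.edgeSet_fromEdgeSet] at he
          exact absurd he.1 h⟩
    else ε

/-- Two signed graphs are isomorphic if there is an isomorphism of the underlying graphs
that preserves the sign of every edge. -/
def Isomorphic (Γ : SignedGraph V) (Δ : SignedGraph W) : Prop :=
  ∃ f : Γ.graph ≃g Δ.graph, ∀ (x y : V) (h : Γ.graph.Adj x y),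
    Δ.sign ⟨s(f x, f y), f.map_adj_iff.2 h⟩ = Γ.sign ⟨s(x, y), h⟩

section Laplacian

open Classical in
/-- The adjacency matrix: the sign of the edge at adjacent pairs, and `0` elsewhere. -/
noncomputable def adjMatrix (Γ : SignedGraph V) : Matrix V V ℝ :=
  Matrix.of fun x y => if h : Γ.graph.Adj x y then (((Γ.sign ⟨s(x, y), h⟩ : ℤˣ) : ℤ) : ℝ) else 0

variable [Fintype V] [DecidableEq V] [Fintype W] [DecidableEq W]

open Classical in
/-- The Laplacian matrix `D - A`, with `D` the degree matrix of the underlying graph. -/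
noncomputable def lapMatrix (Γ : SignedGraph V) : Matrix V V ℝ :=
  Γ.graph.degMatrix ℝ - Γ.adjMatrix

/-- The Laplacian spectrum: the roots of the Laplacian characteristic polynomial, that is the
eigenvalues of the (real symmetric) Laplacian matrix, with multiplicities. -/
noncomputable def lapSpectrum (Γ : SignedGraph V) : Multiset ℝ := Γ.lapMatrix.charpoly.roots

/-- Laplacian cospectral: equal Laplacian spectra, with multiplicities. -/
def LapCospectral (Γ : SignedGraph V) (Δ : SignedGraph W) : Prop :=
  Γ.lapSpectrum = Δ.lapSpectrum

end Laplacian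

/-! In the following, the vertex set is the disjoint union of `V₁ = {u i}` and `V₂ = {v i}`,
both indexed by `ι`, with `u i = Sum.inl i` and `v i = Sum.inr i`. -/

section PartialTranspose

variable {ι : Type*}

/-- The spanning signed subgraph formed by the edges between `V₁` and `V₂`. -/
def between (Γ : SignedGraph (ι ⊕ ι)) : SignedGraph (ι ⊕ ι) :=
  Γ.removeEdges {e | ¬ ∃ i j : ι, e = s(Sum.inl i, Sum.inr j)}

/-- The map on pairs of vertices that sends `(u i, v j)` to `(u j, v i)` and fixes the pairs
inside `V₁` and the pairs inside `V₂`. -/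
def transposePair : Sym2 (ι ⊕ ι) → Sym2 (ι ⊕ ι) :=
  Sym2.lift ⟨fun x y =>
    match x, y with
    | .inl i, .inl j => s(.inl i, .inl j)
    | .inl i, .inr j => s(.inl j, .inr i)
    | .inr i, .inl j => s(.inl i, .inr j)
    | .inr i, .inr j => s(.inr i, .inr j), by
    rintro (i | i) (j | j)
    · exact Sym2.eq_swap
    · rfl
    · rfl
    · exact Sym2.eq_swap⟩

/-- The partial transpose: edges inside `V₁` and inside `V₂` are kept with their signs, and
`(u i, v j)` is an edge of the partial transpose exactly if `(u j, v i)` is an edge of `Γ`,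
with the same sign. (`transposePair` is an involution, so this preimage is also the image.) -/
def partialTranspose (Γ : SignedGraph (ι ⊕ ι)) : SignedGraph (ι ⊕ ι) where
  graph := SimpleGraph.fromEdgeSet (transposePair ⁻¹' Γ.graph.edgeSet)
  sign e := Γ.sign ⟨transposePair e.1, by
    obtain ⟨e, he⟩ := e
    rw [SimpleGraph.edgeSet_fromEdgeSet] at he
    exact he.1⟩

end PartialTranspose

end SignedGraph

open Matrix

/-! Let `K = 2I - A(P_n)`, and let `S` switch the sign at the last vertex to `ε`: `ε = 1` for the
pair in (i), `ε = -1` for the pair in (ii). In each pair both Laplacians are rank-two perturbations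
of the same block diagonal matrix with blocks `S K S` and `K`, touching only the end vertices of the
paths. By the matrix determinant lemma, `det (x - L)` therefore depends only on the four corner
entries of `(x - K)⁻¹`. Symmetry of `K` and reversal of the path leave two unknowns, `a` on the
diagonal and `b` off it, with `ε b` in the switched block. The two resulting 2×2 determinants differ
by `(b² - a²)(ε² - 1) = 0` (`det_rankTwo_perturbations_eq`, `charpoly_rankTwo_perturbations_eq`).

Non-isomorphism comes from degrees: `u first` has degree 4 in one graph, and the other has maximum
degree 3. -/

theorem Matrix.det_add_vecMulVec_add_vecMulVec {κ : Type*} [Fintype κ] [DecidableEq κ]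
    (D : Matrix κ κ ℝ) (hD : IsUnit D.det) (p q r s : κ → ℝ) :
    (D + vecMulVec p q + vecMulVec r s).det = D.det *
      ((1 + q ⬝ᵥ D⁻¹ *ᵥ p) * (1 + s ⬝ᵥ D⁻¹ *ᵥ r) - (q ⬝ᵥ D⁻¹ *ᵥ r) * (s ⬝ᵥ D⁻¹ *ᵥ p)) := by
  have h : D + vecMulVec p q + vecMulVec r s
      = D + (Matrix.of ![p, r])ᵀ * Matrix.of ![q, s] := by
    ext i j
    simp [Matrix.mul_apply, vecMulVec_apply, Fin.sum_univ_two, add_assoc]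
  rw [h, Matrix.det_add_mul _ _ hD, Matrix.det_fin_two]
  have key : ∀ i j : Fin 2, (Matrix.of ![q, s] * D⁻¹ * (Matrix.of ![p, r])ᵀ) i j
      = ![q, s] i ⬝ᵥ D⁻¹ *ᵥ ![p, r] j := by
    intro i j
    rw [Matrix.mul_assoc]
    rfl
  simp only [Matrix.add_apply, key]
  simp

/-! ### Rank-two perturbations of two decoupled blocks. -/

section TwoBlocks

variable {ι : Type*} [Fintype ι] [DecidableEq ι]

theorem Matrix.elim_dotProduct_fromBlocks_inv_mulVec (A C : Matrix ι ι ℝ) (hA : IsUnit A.det)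
    (hC : IsUnit C.det) (p q r s : ι → ℝ) :
    Sum.elim p q ⬝ᵥ (fromBlocks A 0 0 C)⁻¹ *ᵥ Sum.elim r s
      = p ⬝ᵥ A⁻¹ *ᵥ r + q ⬝ᵥ C⁻¹ *ᵥ s := by
  have h : (fromBlocks A 0 0 C)⁻¹ = fromBlocks A⁻¹ 0 0 C⁻¹ := by
    apply Matrix.inv_eq_right_inv
    simp [fromBlocks_multiply, Matrix.mul_nonsing_inv _ hA, Matrix.mul_nonsing_inv _ hC]
  rw [h, fromBlocks_mulVec]
  simp [sumElim_dotProduct_sumElim]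

theorem Matrix.det_rankTwo_perturbations_eq (A C : Matrix ι ι ℝ) (hA : IsUnit A.det)
    (hC : IsUnit C.det) (f l : ι) (ε a b : ℝ) (hε : ε * ε = 1)
    (hAff : A⁻¹ f f = a) (hAll : A⁻¹ l l = a) (hAfl : A⁻¹ f l = ε * b) (hAlf : A⁻¹ l f = ε * b)
    (hCff : C⁻¹ f f = a) (hCll : C⁻¹ l l = a) (hCfl : C⁻¹ f l = b) (hClf : C⁻¹ l f = b) :
    (fromBlocks (A - (2 * single f f 1 - single f l 1 - single l f 1))
      (-(single f f ε - single f l 1)) (-(single f f ε - single l f 1)) C).det =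
    (fromBlocks (A - (single f f 1 + single l l 1 - single f l 1 - single l f 1))
      (-(single f f 1 - single l f 1)) (-(single f f 1 - single f l 1))
      (C - (single f f 1 - single l l 1))).det := by
  -- This perturbation lives in the row and column of `u f`, hence has rank two.
  have e1 : fromBlocks (A - (2 * single f f 1 - single f l 1 - single l f 1))
      (-(single f f ε - single f l 1)) (-(single f f ε - single l f 1)) C
      = fromBlocks A 0 0 C
        + vecMulVec (Sum.elim (Pi.single f 1) 0)
          (Sum.elim (-(2 : ℝ) • Pi.single f 1 + Pi.single l 1) (-ε • Pi.single f 1 + Pi.single l 1))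
        + vecMulVec (Sum.elim (Pi.single l 1) (-ε • Pi.single f 1 + Pi.single l 1))
          (Sum.elim (Pi.single f 1) 0) := by
    ext (i | i) (j | j) <;>
      simp only [two_mul, vecMulVec_apply, single_apply, Pi.single_apply, fromBlocks_apply₁₁,
        fromBlocks_apply₁₂, fromBlocks_apply₂₁, fromBlocks_apply₂₂, Matrix.add_apply,
        Matrix.sub_apply, Matrix.neg_apply, Sum.elim_inl, Sum.elim_inr, Pi.add_apply, Pi.smul_apply,
        Pi.zero_apply, Matrix.zero_apply, smul_eq_mul] <;> grind
  -- Here it is `-w wᵀ + z zᵀ`: `w = (e_f - e_l, e_f)` encodes the signed triangle on `u f`, `u l`,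
  -- `v f`, and `z = (0, e_l)` the lowered degree of `v l`.
  have e2 : fromBlocks (A - (single f f 1 + single l l 1 - single f l 1 - single l f 1))
      (-(single f f 1 - single l f 1)) (-(single f f 1 - single f l 1))
      (C - (single f f 1 - single l l 1))
      = fromBlocks A 0 0 C
        + vecMulVec (Sum.elim (Pi.single f 1 - Pi.single l 1) (Pi.single f 1))
          (Sum.elim (Pi.single l 1 - Pi.single f 1) (-Pi.single f 1))
        + vecMulVec (Sum.elim 0 (Pi.single l 1)) (Sum.elim 0 (Pi.single l 1)) := by
    ext (i | i) (j | j) <;>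
      simp only [vecMulVec_apply, single_apply, Pi.single_apply, fromBlocks_apply₁₁,
        fromBlocks_apply₁₂, fromBlocks_apply₂₁, fromBlocks_apply₂₂, Matrix.add_apply,
        Matrix.sub_apply, Matrix.neg_apply, Sum.elim_inl, Sum.elim_inr, Pi.sub_apply, Pi.neg_apply,
        Pi.zero_apply, Matrix.zero_apply] <;> grind
  have hD : IsUnit (fromBlocks A 0 0 C).det := by
    rw [det_fromBlocks_zero₂₁]; exact hA.mul hC
  rw [e1, e2, det_add_vecMulVec_add_vecMulVec _ hD, det_add_vecMulVec_add_vecMulVec _ hD]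
  congr 1
  simp only [elim_dotProduct_fromBlocks_inv_mulVec A C hA hC]
  simp only [mulVec_add, mulVec_sub, mulVec_smul, add_dotProduct, sub_dotProduct,
    neg_dotProduct, smul_dotProduct, dotProduct_add, dotProduct_sub,
    dotProduct_smul, mulVec_zero, dotProduct_zero, zero_dotProduct, mulVec_single_one,
    single_dotProduct, col_apply, smul_eq_mul, *]
  linear_combination (b * b - a * a) * hε

theorem Matrix.charpoly_rankTwo_perturbations_eq (K : Matrix ι ι ℝ) (hK : K.IsSymm)
    (ρ : ι ≃ ι) (hρ : K.submatrix ρ ρ = K) (f l : ι) (hfl : f ≠ l) (hf : ρ f = l) (ε : ℝ)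
    (hε : ε * ε = 1) (K' : Matrix ι ι ℝ)
    (hK' : K' = diagonal (fun i => if i = l then ε else 1) * K *
      diagonal (fun i => if i = l then ε else 1)) :
    (fromBlocks (K' + (2 * single f f 1 - single f l 1 - single l f 1))
      (single f f ε - single f l 1) (single f f ε - single l f 1) K).charpoly =
    (fromBlocks (K' + (single f f 1 + single l l 1 - single f l 1 - single l f 1))
      (single f f 1 - single l f 1) (single f f 1 - single f l 1)
      (K + (single f f 1 - single l l 1))).charpoly := by
  set S : Matrix ι ι ℝ := diagonal (fun i => if i = l then ε else 1) with hS
  have hSS : S * S = 1 := by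
    rw [hS, diagonal_mul_diagonal, ← diagonal_one]
    congr 1
    ext i
    split_ifs <;> simp [hε]
  apply Polynomial.eq_of_infinite_eval_eq
  -- It suffices to compare the polynomials off the eigenvalues of `K`, where the resolvent exists.
  have hinf : {x : ℝ | K.charpoly.eval x = 0}ᶜ.Infinite :=
    (Polynomial.finite_setOfPred_isRoot K.charpoly_monic.ne_zero).infinite_compl
  refine hinf.mono fun x hx => ?_
  simp only [Set.mem_ofPred_eq, Set.mem_compl_iff, eval_charpoly] at hx ⊢
  set C := scalar ι x - K with hC
  have hCu : IsUnit C.det := isUnit_iff_ne_zero.2 hx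
  have hA : scalar ι x - K' = S * C * S := by
    rw [hK', hC, mul_sub, sub_mul, (scalar_commute x (fun _ => Commute.all _ _) S).symm.eq,
      mul_assoc (scalar ι x), hSS, mul_one]
  have hAi : (S * C * S)⁻¹ = S * C⁻¹ * S := by
    apply inv_eq_right_inv
    calc S * C * S * (S * C⁻¹ * S) = S * C * (S * S) * C⁻¹ * S := by noncomm_ring
      _ = S * (C * C⁻¹) * S := by rw [hSS]; noncomm_ring
      _ = 1 := by rw [mul_nonsing_inv _ hCu, mul_one, hSS]
  have hCsymm : C⁻¹ᵀ = C⁻¹ := by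
    rw [transpose_nonsing_inv, hC, transpose_sub, hK.eq, scalar_apply, diagonal_transpose]
  -- The resolvent inherits the symmetry `ρ`, which makes its two diagonal corner entries equal.
  have hCρ : C⁻¹.submatrix ρ ρ = C⁻¹ := by
    rw [← inv_submatrix_equiv, hC]
    congr 1
    ext i j
    have h := congrFun₂ hρ i j
    simp only [submatrix_apply, Matrix.sub_apply, scalar_apply, diagonal_apply,
      ρ.injective.eq_iff] at h ⊢
    rw [h]
  have hlf : C⁻¹ l f = C⁻¹ f l := congrFun₂ hCsymm f l
  have hll : C⁻¹ l l = C⁻¹ f f := by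
    rw [← hf]; exact congrFun₂ hCρ f f
  have hSC : ∀ i j, (S * C⁻¹ * S) i j
      = (if i = l then ε else 1) * C⁻¹ i j * (if j = l then ε else 1) := by
    intro i j
    rw [hS, mul_diagonal, diagonal_mul]
  have hdet : IsUnit (S * C * S).det := by
    have h1 : S.det * S.det = 1 := by rw [← det_mul, hSS, det_one]
    have h2 : IsUnit S.det := IsUnit.of_mul_eq_one _ h1
    rw [det_mul, det_mul]
    exact (h2.mul hCu).mul h2
  have hsc : scalar (ι ⊕ ι) x = fromBlocks (scalar ι x) 0 0 (scalar ι x) := by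
    simp [scalar_apply, fromBlocks_diagonal]
  have key := det_rankTwo_perturbations_eq (S * C * S) C hdet hCu f l ε (C⁻¹ f f) (C⁻¹ f l) hε
    (by rw [hAi, hSC]; simp [hfl])
    (by rw [hAi, hSC]; simp [hll]; linear_combination (C⁻¹ f f) * hε)
    (by rw [hAi, hSC]; simp [hfl]; ring)
    (by rw [hAi, hSC]; simp [hfl, hlf]) rfl hll rfl hlf
  rw [← hA] at key
  simp only [hsc, sub_eq_add_neg, fromBlocks_neg, fromBlocks_add, zero_add, hC, neg_add,
    add_assoc] at key ⊢
  exact key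

end TwoBlocks

/-! ### Signed adjacency matrices and their Laplacians. -/

namespace SignedGraph

variable {V W : Type*}

theorem adjMatrix_of_adj (Γ : SignedGraph V) {x y : V} (h : Γ.graph.Adj x y) :
    Γ.adjMatrix x y = (((Γ.sign ⟨s(x, y), h⟩ : ℤˣ) : ℤ) : ℝ) := by
  simp [adjMatrix, h]

theorem adjMatrix_of_not_adj (Γ : SignedGraph V) {x y : V} (h : ¬ Γ.graph.Adj x y) :
    Γ.adjMatrix x y = 0 := by
  simp [adjMatrix, h]

open Classical in
theorem adjMatrix_sq (Γ : SignedGraph V) (x y : V) :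
    Γ.adjMatrix x y ^ 2 = if Γ.graph.Adj x y then 1 else 0 := by
  by_cases h : Γ.graph.Adj x y
  · rw [adjMatrix_of_adj Γ h, if_pos h]
    rcases Int.units_eq_one_or (Γ.sign ⟨s(x, y), h⟩) with h | h <;> simp [h]
  · simp [adjMatrix_of_not_adj Γ h, h]

/-- The signed Laplacian as a function of the signed adjacency matrix. -/
noncomputable def lapOfAdj [Fintype V] [DecidableEq V] (A : Matrix V V ℝ) : Matrix V V ℝ :=
  diagonal (fun x => ∑ y, A x y ^ 2) - A

/-- Adjacency entries are `0` or `±1`, so their squares count neighbours. From here on only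
adjacency matrices need to be tracked. -/
theorem lapMatrix_eq_lapOfAdj [Fintype V] [DecidableEq V] (Γ : SignedGraph V) :
    Γ.lapMatrix = lapOfAdj Γ.adjMatrix := by
  classical
  rw [lapMatrix, lapOfAdj, SimpleGraph.degMatrix]
  congr 2
  ext x
  simp only [adjMatrix_sq, Finset.sum_boole, ← SimpleGraph.card_neighborFinset_eq_degree,
    SimpleGraph.neighborFinset_eq_filter]

theorem adjMatrix_addEdge (Γ : SignedGraph V) {a b : V} (hab : a ≠ b) (ε : ℤˣ) (x y : V)
    [Decidable (s(x, y) = s(a, b))] :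
    (Γ.addEdge a b ε).adjMatrix x y
      = if s(x, y) = s(a, b) then ((ε : ℤ) : ℝ) else Γ.adjMatrix x y := by
  have hadj : (Γ.addEdge a b ε).graph.Adj x y ↔ Γ.graph.Adj x y ∨ s(x, y) = s(a, b) := by
    simp only [addEdge, SimpleGraph.sup_adj, SimpleGraph.edge_adj, Sym2.eq_iff]
    grind
  split_ifs with h
  · rw [adjMatrix_of_adj _ (hadj.2 (Or.inr h))]
    simp [addEdge, h]
  · by_cases hΓ : Γ.graph.Adj x y
    · rw [adjMatrix_of_adj _ (hadj.2 (Or.inl hΓ)), adjMatrix_of_adj _ hΓ]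
      simp [addEdge, h]
    · rw [adjMatrix_of_not_adj _ hΓ, adjMatrix_of_not_adj _ (by simp [hadj, h, hΓ])]

theorem adjMatrix_removeEdges (Γ : SignedGraph V) (S : Set (Sym2 V)) (x y : V)
    [Decidable (s(x, y) ∈ S)] :
    (Γ.removeEdges S).adjMatrix x y = if s(x, y) ∈ S then 0 else Γ.adjMatrix x y := by
  have hadj : (Γ.removeEdges S).graph.Adj x y ↔ Γ.graph.Adj x y ∧ s(x, y) ∉ S := by
    simp [removeEdges, SimpleGraph.deleteEdges_adj]
  split_ifs with h
  · exact adjMatrix_of_not_adj _ (by simp [hadj, h])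
  · by_cases hΓ : Γ.graph.Adj x y
    · rw [adjMatrix_of_adj _ (hadj.2 ⟨hΓ, h⟩), adjMatrix_of_adj _ hΓ]
      rfl
    · rw [adjMatrix_of_not_adj _ hΓ, adjMatrix_of_not_adj _ (by simp [hadj, hΓ])]

open Classical in
theorem adjMatrix_of_allPositive (Γ : SignedGraph V) (h : Γ.AllPositive) :
    Γ.adjMatrix = Γ.graph.adjMatrix ℝ := by
  ext x y
  by_cases hΓ : Γ.graph.Adj x y
  · simp [adjMatrix_of_adj _ hΓ, h _, hΓ]
  · simp [adjMatrix_of_not_adj _ hΓ, hΓ]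

theorem adjMatrix_partialTranspose {ι : Type*} (Γ : SignedGraph (ι ⊕ ι)) :
    Γ.partialTranspose.adjMatrix = fromBlocks Γ.adjMatrix.toBlocks₁₁ Γ.adjMatrix.toBlocks₁₂ᵀ
      Γ.adjMatrix.toBlocks₂₁ᵀ Γ.adjMatrix.toBlocks₂₂ := by
  have key : ∀ x y x' y' : ι ⊕ ι, x ≠ y → transposePair s(x, y) = s(x', y') →
      Γ.partialTranspose.adjMatrix x y = Γ.adjMatrix x' y' := by
    intro x y x' y' hne h
    have hadj : Γ.partialTranspose.graph.Adj x y ↔ Γ.graph.Adj x' y' := by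
      simp [partialTranspose, h, hne]
    by_cases hΓ : Γ.graph.Adj x' y'
    · rw [adjMatrix_of_adj _ (hadj.2 hΓ), adjMatrix_of_adj _ hΓ]
      simp [partialTranspose, h]
    · rw [adjMatrix_of_not_adj _ hΓ, adjMatrix_of_not_adj _ (by simp [hadj, hΓ])]
  -- `fromEdgeSet` discards loops, so `key` needs distinct vertices and the diagonal is treated
  -- apart.
  have hdiag : ∀ (Δ : SignedGraph (ι ⊕ ι)) (x : ι ⊕ ι), Δ.adjMatrix x x = 0 :=
    fun Δ x => adjMatrix_of_not_adj _ (Δ.graph.irrefl)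
  ext (i | i) (j | j)
  · by_cases hij : i = j
    · subst hij; simp [hdiag, toBlocks₁₁]
    · exact key _ _ _ _ (by simpa using hij) rfl
  · exact key _ _ _ _ (by simp) rfl
  · exact key _ _ _ _ (by simp) Sym2.eq_swap
  · by_cases hij : i = j
    · subst hij; simp [hdiag, toBlocks₂₂]
    · exact key _ _ _ _ (by simpa using hij) rfl

open Classical in
theorem lapMatrix_diag [Fintype V] [DecidableEq V] (Γ : SignedGraph V) (x : V) :
    Γ.lapMatrix x x = Γ.graph.degree x := by
  simp only [lapMatrix, Matrix.sub_apply, adjMatrix_of_not_adj Γ Γ.graph.irrefl, sub_zero,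
    SimpleGraph.degMatrix, diagonal_apply_eq]

theorem Isomorphic.exists_lapMatrix_diag [Fintype V] [DecidableEq V] [Fintype W] [DecidableEq W]
    {Γ : SignedGraph V} {Δ : SignedGraph W} (h : Γ.Isomorphic Δ) (x : V) :
    ∃ y, Δ.lapMatrix y y = Γ.lapMatrix x x := by
  classical
  obtain ⟨f, -⟩ := h
  exact ⟨f x, by rw [lapMatrix_diag, lapMatrix_diag, f.degree_eq]⟩

theorem lapOfAdj_fromBlocks [Fintype V] [DecidableEq V] [Fintype W] [DecidableEq W]
    (A : Matrix V V ℝ) (B : Matrix V W ℝ) (C : Matrix W V ℝ) (D : Matrix W W ℝ) :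
    lapOfAdj (fromBlocks A B C D)
      = fromBlocks (lapOfAdj A + diagonal fun i => ∑ j, B i j ^ 2) (-B) (-C)
        (lapOfAdj D + diagonal fun i => ∑ j, C i j ^ 2) := by
  ext (i | i) (j | j) <;> simp [lapOfAdj, diagonal_apply] <;> split_ifs <;> ring

theorem lapOfAdj_submatrix [Fintype V] [DecidableEq V] [Fintype W] [DecidableEq W]
    (A : Matrix V V ℝ) (e : W ≃ V) :
    lapOfAdj (A.submatrix e e) = (lapOfAdj A).submatrix e e := by
  ext i j
  simp [lapOfAdj, diagonal_apply, Equiv.sum_comp e (fun y => A (e i) y ^ 2)]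

section Switching

variable [Fintype V] [DecidableEq V]

/-- Switching changes no squared entry, so degrees are unaffected. -/
theorem lapOfAdj_switch (A : Matrix V V ℝ) (s : V → ℝ) (hs : ∀ i, s i * s i = 1) :
    lapOfAdj (diagonal s * A * diagonal s) = diagonal s * lapOfAdj A * diagonal s := by
  ext i j
  have h : ∀ y, (s i * A i y * s y) ^ 2 = A i y ^ 2 := fun y => by
    linear_combination (A i y ^ 2 * s y * s y) * hs i + A i y ^ 2 * hs y
  simp only [lapOfAdj, mul_diagonal, diagonal_mul, Matrix.sub_apply, h, diagonal_apply]
  split_ifs with hij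
  · subst hij
    linear_combination -(∑ y, A i y ^ 2) * hs i
  · ring

theorem lapOfAdj_add_edge (A : Matrix V V ℝ) {a b : V} (hab : a ≠ b) (h₁ : A a b = 0)
    (h₂ : A b a = 0) :
    lapOfAdj (A + single a b 1 + single b a 1)
      = lapOfAdj A + (single a a 1 + single b b 1 - single a b 1 - single b a 1) := by
  have h : ∀ i j, (A + single a b 1 + single b a 1 : Matrix V V ℝ) i j ^ 2
      = A i j ^ 2 + (if j = b then if i = a then 1 else 0 else 0)
        + (if j = a then if i = b then 1 else 0 else 0) := by
    intro i j
    simp only [Matrix.add_apply, single_apply]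
    grind
  ext i j
  rw [lapOfAdj, Matrix.sub_apply, diagonal_apply]
  simp only [h, Finset.sum_add_distrib, Finset.sum_ite_eq', Finset.mem_univ, if_true]
  simp only [lapOfAdj, Matrix.sub_apply, diagonal_apply, Matrix.add_apply, single_apply]
  grind

end Switching

/-! ### The path and its reversal-symmetric matrix `2I - A(P_n)`. -/

/-- The adjacency matrix of the path on `n` vertices. -/
noncomputable def pathAdj (n : ℕ) : Matrix (Fin n) (Fin n) ℝ :=
  Matrix.of fun i j => if i.val + 1 = j.val ∨ j.val + 1 = i.val then 1 else 0

theorem pathGraph_adjMatrix (n : ℕ) [DecidableRel (SimpleGraph.pathGraph n).Adj] :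
    (SimpleGraph.pathGraph n).adjMatrix ℝ = pathAdj n := by
  ext i j
  simp [pathAdj, SimpleGraph.adjMatrix_apply, SimpleGraph.pathGraph_adj]

theorem pathAdj_isSymm (n : ℕ) : (pathAdj n).IsSymm := by
  ext i j
  simp [pathAdj, or_comm]

theorem lapOfAdj_pathAdj_diag {n : ℕ} (i : Fin n) :
    lapOfAdj (pathAdj n) i i
      = (if i.val + 1 < n then 1 else 0) + (if 0 < i.val then 1 else 0) := by
  have h : ∀ j, pathAdj n i j ^ 2
      = (if i.val + 1 = j.val then 1 else 0) + (if j.val + 1 = i.val then 1 else 0) := by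
    intro j
    simp only [pathAdj, of_apply]
    split_ifs <;> first | omega | norm_num
  have h₁ : ∑ j : Fin n, (if i.val + 1 = j.val then (1 : ℝ) else 0)
      = if i.val + 1 < n then 1 else 0 := by
    split_ifs with hi
    · rw [Finset.sum_eq_single (⟨i.val + 1, hi⟩ : Fin n)] <;> simp [Fin.ext_iff, eq_comm]
    · exact Finset.sum_eq_zero fun j _ => if_neg (by omega)
  have h₂ : ∑ j : Fin n, (if j.val + 1 = i.val then (1 : ℝ) else 0)
      = if 0 < i.val then 1 else 0 := by
    split_ifs with hi
    · rw [Finset.sum_eq_single (⟨i.val - 1, by omega⟩ : Fin n)]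
      · exact if_pos (by simp; omega)
      · exact fun j _ hj => if_neg fun h => hj (Fin.ext (by simp; omega))
      · simp
    · exact Finset.sum_eq_zero fun j _ => if_neg (by omega)
  simp only [lapOfAdj, Matrix.sub_apply, diagonal_apply_eq, h, Finset.sum_add_distrib, h₁, h₂]
  simp [pathAdj]

/-- The Laplacian of the path with its two end degrees raised to `2`. -/
noncomputable def dirichletLap {n : ℕ} (f l : Fin n) : Matrix (Fin n) (Fin n) ℝ :=
  lapOfAdj (pathAdj n) + single f f 1 + single l l 1

theorem dirichletLap_diag {n : ℕ} {f l : Fin n} (hf : f.val = 0) (hl : l.val = n - 1)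
    (i : Fin n) : dirichletLap f l i i = 2 := by
  simp only [dirichletLap, Matrix.add_apply, lapOfAdj_pathAdj_diag, single_apply, and_self,
    Fin.ext_iff, hf, hl]
  have := i.isLt
  split_ifs <;> first | omega | norm_num

theorem dirichletLap_isSymm {n : ℕ} (f l : Fin n) : (dirichletLap f l).IsSymm := by
  rw [IsSymm, dirichletLap, lapOfAdj]
  simp only [transpose_add, transpose_sub, diagonal_transpose, (pathAdj_isSymm n).eq,
    transpose_single]

theorem dirichletLap_rev {n : ℕ} {f l : Fin n} (hf : f.val = 0) (hl : l.val = n - 1) :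
    (dirichletLap f l).submatrix Fin.revPerm Fin.revPerm = dirichletLap f l := by
  have h : (pathAdj n).submatrix Fin.revPerm Fin.revPerm = pathAdj n := by
    ext i j
    simp only [pathAdj, submatrix_apply, of_apply, Fin.revPerm_apply, Fin.val_rev]
    congr 1
    rw [eq_iff_iff]
    omega
  ext i j
  have h' := congrFun₂ (lapOfAdj_submatrix (pathAdj n) Fin.revPerm) i j
  rw [h, submatrix_apply] at h'
  simp only [dirichletLap, submatrix_apply, Matrix.add_apply, h', single_apply, Fin.ext_iff,
    Fin.revPerm_apply, Fin.val_rev, hf, hl]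
  have := i.isLt
  have := j.isLt
  split_ifs <;> first | omega | simp

/-- The diagonal matrix that switches the sign at `l` to `ε`. -/
noncomputable def switchAt {n : ℕ} (l : Fin n) (ε : ℝ) : Matrix (Fin n) (Fin n) ℝ :=
  diagonal fun i => if i = l then ε else 1

theorem switchAt_mul_mul_apply {n : ℕ} (l : Fin n) (ε : ℝ) (A : Matrix (Fin n) (Fin n) ℝ)
    (i j : Fin n) : (switchAt l ε * A * switchAt l ε) i j
      = (if i = l then ε else 1) * A i j * (if j = l then ε else 1) := by
  rw [switchAt, mul_diagonal, diagonal_mul]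

/-- Closing the path to a cycle supplies exactly the extra end degrees in `dirichletLap`. The
closing edge is added after switching, so it stays positive; `3 ≤ n` makes it a new edge. -/
theorem lapOfAdj_cycle_block {n : ℕ} (hn : 3 ≤ n) {f l : Fin n} (hf : f.val = 0)
    (hl : l.val = n - 1) {ε : ℝ} (hε : ε * ε = 1) :
    lapOfAdj (switchAt l ε * pathAdj n * switchAt l ε + single f l 1 + single l f 1)
      = switchAt l ε * dirichletLap f l * switchAt l ε - single f l 1 - single l f 1 := by
  have hfl : f ≠ l := fun h => by rw [h] at hf; omega
  have h₁ : pathAdj n f l = 0 := if_neg (by omega)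
  have h₂ : pathAdj n l f = 0 := if_neg (by omega)
  rw [lapOfAdj_add_edge _ hfl (by rw [switchAt_mul_mul_apply, h₁]; simp)
    (by rw [switchAt_mul_mul_apply, h₂]; simp), switchAt, lapOfAdj_switch, ← switchAt]
  · ext i j
    simp only [dirichletLap, Matrix.add_apply, Matrix.sub_apply, switchAt_mul_mul_apply,
      single_apply]
    grind
  · intro i
    split_ifs <;> simp [hε]

theorem sum_sq_single_sub_single_row {n : ℕ} {f l : Fin n} (hfl : f ≠ l) {ε : ℝ}
    (hε : ε * ε = 1) (i : Fin n) :
    ∑ j, (single f l 1 - single f f ε : Matrix (Fin n) (Fin n) ℝ) i j ^ 2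
      = if i = f then 2 else 0 := by
  have : ∀ j, (single f l 1 - single f f ε : Matrix (Fin n) (Fin n) ℝ) i j ^ 2
      = (if j = l then if i = f then 1 else 0 else 0)
        + (if j = f then if i = f then 1 else 0 else 0) := by
    intro j
    simp only [Matrix.sub_apply, single_apply]
    grind
  simp only [this, Finset.sum_add_distrib, Finset.sum_ite_eq', Finset.mem_univ, if_true]
  split_ifs <;> norm_num

theorem sum_sq_single_sub_single_col {n : ℕ} {f l : Fin n} (hfl : f ≠ l) {ε : ℝ}
    (hε : ε * ε = 1) (i : Fin n) :
    ∑ j, (single l f 1 - single f f ε : Matrix (Fin n) (Fin n) ℝ) i j ^ 2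
      = (if i = l then 1 else 0) + (if i = f then 1 else 0) := by
  have : ∀ j, (single l f 1 - single f f ε : Matrix (Fin n) (Fin n) ℝ) i j ^ 2
      = if j = f then (if i = l then 1 else 0) + (if i = f then 1 else 0) else 0 := by
    intro j
    simp only [Matrix.sub_apply, single_apply]
    grind
  simp only [this, Finset.sum_ite_eq', Finset.mem_univ, if_true]

/-! ### The Laplacians of the two families, and their comparison. -/

theorem lapMatrix_of_hub {n : ℕ} (hn : 3 ≤ n) {f l : Fin n} (hf : f.val = 0) (hl : l.val = n - 1)
    {ε : ℝ} (hε : ε * ε = 1) (Γ : SignedGraph (Fin n ⊕ Fin n))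
    (hΓ : Γ.adjMatrix = fromBlocks
      (switchAt l ε * pathAdj n * switchAt l ε + single f l 1 + single l f 1)
      (single f l 1 - single f f ε) (single l f 1 - single f f ε) (pathAdj n)) :
    Γ.lapMatrix = fromBlocks
      (switchAt l ε * dirichletLap f l * switchAt l ε
        + (2 * single f f 1 - single f l 1 - single l f 1))
      (single f f ε - single f l 1) (single f f ε - single l f 1) (dirichletLap f l) := by
  have hfl : f ≠ l := fun h => by rw [h] at hf; omega
  rw [lapMatrix_eq_lapOfAdj, hΓ, lapOfAdj_fromBlocks, lapOfAdj_cycle_block hn hf hl hε]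
  simp only [sum_sq_single_sub_single_row hfl hε, sum_sq_single_sub_single_col hfl hε, neg_sub]
  congr 1
  · ext i j
    simp only [two_mul, Matrix.add_apply, Matrix.sub_apply, diagonal_apply, single_apply]
    grind
  · ext i j
    simp only [dirichletLap, Matrix.add_apply, diagonal_apply, single_apply]
    grind

theorem lapMatrix_of_triangle {n : ℕ} (hn : 3 ≤ n) {f l : Fin n} (hf : f.val = 0)
    (hl : l.val = n - 1) {ε : ℝ} (hε : ε * ε = 1) (Γ : SignedGraph (Fin n ⊕ Fin n))
    (hΓ : Γ.adjMatrix = fromBlocks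
      (switchAt l ε * pathAdj n * switchAt l ε + single f l 1 + single l f 1)
      (single l f 1 - single f f 1) (single f l 1 - single f f 1) (pathAdj n)) :
    Γ.lapMatrix = fromBlocks
      (switchAt l ε * dirichletLap f l * switchAt l ε
        + (single f f 1 + single l l 1 - single f l 1 - single l f 1))
      (single f f 1 - single l f 1) (single f f 1 - single f l 1)
      (dirichletLap f l + (single f f 1 - single l l 1)) := by
  have hfl : f ≠ l := fun h => by rw [h] at hf; omega
  rw [lapMatrix_eq_lapOfAdj, hΓ, lapOfAdj_fromBlocks, lapOfAdj_cycle_block hn hf hl hε]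
  simp only [sum_sq_single_sub_single_row hfl (mul_one 1),
    sum_sq_single_sub_single_col hfl (mul_one 1), neg_sub]
  congr 1
  · ext i j
    simp only [Matrix.add_apply, Matrix.sub_apply, diagonal_apply, single_apply]
    grind
  · ext i j
    simp only [dirichletLap, Matrix.add_apply, Matrix.sub_apply, diagonal_apply, single_apply]
    grind

theorem not_isomorphic_and_lapCospectral {n : ℕ} (hn : 3 ≤ n) {f l : Fin n} (hf : f.val = 0)
    (hl : l.val = n - 1) {ε : ℝ} (hε : ε * ε = 1) (Γ Δ : SignedGraph (Fin n ⊕ Fin n))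
    (hΓ : Γ.adjMatrix = fromBlocks
      (switchAt l ε * pathAdj n * switchAt l ε + single f l 1 + single l f 1)
      (single f l 1 - single f f ε) (single l f 1 - single f f ε) (pathAdj n))
    (hΔ : Δ.adjMatrix = fromBlocks
      (switchAt l ε * pathAdj n * switchAt l ε + single f l 1 + single l f 1)
      (single l f 1 - single f f 1) (single f l 1 - single f f 1) (pathAdj n)) :
    ¬ Γ.Isomorphic Δ ∧ Γ.LapCospectral Δ := by
  have hfl : f ≠ l := fun h => by rw [h] at hf; omega
  have hLΓ := lapMatrix_of_hub hn hf hl hε Γ hΓ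
  have hLΔ := lapMatrix_of_triangle hn hf hl hε Δ hΔ
  constructor
  · intro h
    -- The diagonal entry at `u f` is `2 + 2 = 4`, while those of `Δ` are at most `3`.
    obtain ⟨y, hy⟩ := h.exists_lapMatrix_diag (Sum.inl f)
    have hdiag : ∀ i, (switchAt l ε * dirichletLap f l * switchAt l ε) i i = 2 := by
      intro i
      rw [switchAt_mul_mul_apply, dirichletLap_diag hf hl]
      split_ifs
      · linear_combination 2 * hε
      · norm_num
    rw [hLΓ, hLΔ] at hy
    rcases y with i | i
    · simp only [two_mul, fromBlocks_apply₁₁, Matrix.add_apply, Matrix.sub_apply, hdiag,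
        single_apply] at hy
      grind
    · simp only [two_mul, fromBlocks_apply₁₁, fromBlocks_apply₂₂, Matrix.add_apply,
        Matrix.sub_apply, hdiag, dirichletLap_diag hf hl, single_apply] at hy
      grind
  · rw [LapCospectral, lapSpectrum, lapSpectrum, hLΓ, hLΔ]
    rw [charpoly_rankTwo_perturbations_eq (dirichletLap f l) (dirichletLap_isSymm f l) Fin.revPerm
      (dirichletLap_rev hf hl) f l hfl (Fin.ext (by simp [hf, hl])) ε hε
      (switchAt l ε * dirichletLap f l * switchAt l ε) rfl]

end SignedGraph

theorem theorem3p1 (n : ℕ) (hn : 3 ≤ n) (u v : Fin n → Fin n ⊕ Fin n)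
    (hu : u = Sum.inl) (hv : v = Sum.inr)
    (first penult last : Fin n) (h_first : first.val = 0) (h_penult : penult.val = n - 2)
    (h_last : last.val = n - 1)
    (Γ Γ₁ Γ₂ Γ₃ : SignedGraph (Fin n ⊕ Fin n))
    (hpath₁ : (Γ.comap u).graph = SimpleGraph.pathGraph n) (hpos₁ : (Γ.comap u).AllPositive)
    (hpath₂ : (Γ.comap v).graph = SimpleGraph.pathGraph n) (hpos₂ : (Γ.comap v).AllPositive)
    (hbetween : Γ.between.graph = ⊥)
    (hΓ₁ : Γ₁ = ((Γ.addEdge (u first) (u last) 1).addEdge (u first) (v first) (-1)).addEdge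
      (u first) (v last) 1)
    (hΓ₂ : Γ₂ = ((Γ₁.removeEdges {s(u penult, u last), s(u first, v first)}).addEdge
      (u penult) (u last) (-1)).addEdge (u first) (v first) 1)
    (hΓ₃ : Γ₃ = (Γ₁.partialTranspose.removeEdges {s(u penult, u last)}).addEdge
      (u penult) (u last) (-1)) :
    (¬ Γ₁.Isomorphic Γ₁.partialTranspose ∧ Γ₁.LapCospectral Γ₁.partialTranspose) ∧
    (¬ Γ₂.Isomorphic Γ₃ ∧ Γ₂.LapCospectral Γ₃) := by
  classical
  subst hu hv
  have hfl : first ≠ last := fun h => by rw [h] at h_first; omega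
  have hpl : penult ≠ last := fun h => by rw [h] at h_penult; omega
  have hu : ∀ i j, Γ.adjMatrix (.inl i) (.inl j) = SignedGraph.pathAdj n i j := by
    intro i j
    have h : Γ.adjMatrix (.inl i) (.inl j) = _ :=
      congrFun₂ (SignedGraph.adjMatrix_of_allPositive _ hpos₁) i j
    simpa only [hpath₁, SignedGraph.pathGraph_adjMatrix] using h
  have hv : ∀ i j, Γ.adjMatrix (.inr i) (.inr j) = SignedGraph.pathAdj n i j := by
    intro i j
    have h : Γ.adjMatrix (.inr i) (.inr j) = _ :=
      congrFun₂ (SignedGraph.adjMatrix_of_allPositive _ hpos₂) i j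
    simpa only [hpath₂, SignedGraph.pathGraph_adjMatrix] using h
  have hnadj : ∀ i j, ¬ Γ.graph.Adj (.inl i) (.inr j) := by
    intro i j h
    have h' : Γ.between.graph.Adj (.inl i) (.inr j) := by
      rw [SignedGraph.between, SignedGraph.removeEdges, SimpleGraph.deleteEdges_adj]
      exact ⟨h, fun h => h ⟨i, j, rfl⟩⟩
    rw [hbetween] at h'
    exact h'
  have huv : ∀ i j, Γ.adjMatrix (.inl i) (.inr j) = 0 := fun i j =>
    SignedGraph.adjMatrix_of_not_adj _ (hnadj i j)
  have hvu : ∀ i j, Γ.adjMatrix (.inr i) (.inl j) = 0 := fun i j =>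
    SignedGraph.adjMatrix_of_not_adj _ fun h => hnadj j i h.symm
  have hP₁ : SignedGraph.pathAdj n first last = 0 := if_neg (by omega)
  have hP₂ : SignedGraph.pathAdj n last first = 0 := if_neg (by omega)
  -- The last vertex is an end of the path, so switching there flips a single edge, the one that is
  -- negative in `Γ₂` and `Γ₃`.
  have hs : ∀ i j, (SignedGraph.switchAt last (-1) * SignedGraph.pathAdj n
      * SignedGraph.switchAt last (-1)) i j
      = if (i = penult ∧ j = last) ∨ (i = last ∧ j = penult) then -1
        else SignedGraph.pathAdj n i j := by
    intro i j
    rw [SignedGraph.switchAt_mul_mul_apply]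
    simp only [SignedGraph.pathAdj, of_apply, Fin.ext_iff, h_penult, h_last]
    have := i.isLt
    have := j.isLt
    split_ifs <;> first | omega | norm_num
  have h₁ : Γ₁.adjMatrix = fromBlocks
      (SignedGraph.pathAdj n + single first last 1 + single last first 1)
      (single first last 1 - single first first 1) (single last first 1 - single first first 1)
      (SignedGraph.pathAdj n) := by
    subst hΓ₁
    ext (i | i) (j | j) <;>
      simp only [SignedGraph.adjMatrix_addEdge _ (show Sum.inl first ≠ Sum.inr last by simp),
        SignedGraph.adjMatrix_addEdge _ (show Sum.inl first ≠ Sum.inr first by simp),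
        SignedGraph.adjMatrix_addEdge _ (show (Sum.inl first : Fin n ⊕ Fin n) ≠ Sum.inl last by
          simpa using hfl), Sym2.eq_iff, hu, hv, huv, hvu, fromBlocks_apply₁₁, fromBlocks_apply₁₂,
        fromBlocks_apply₂₁, fromBlocks_apply₂₂, Matrix.add_apply, Matrix.sub_apply, single_apply,
        Sum.inl.injEq, Sum.inr.injEq, reduceCtorEq, Units.val_neg, Units.val_one, Int.cast_neg,
        Int.cast_one] <;>
      grind
  have h₁' : Γ₁.partialTranspose.adjMatrix = fromBlocks
      (SignedGraph.pathAdj n + single first last 1 + single last first 1)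
      (single last first 1 - single first first 1) (single first last 1 - single first first 1)
      (SignedGraph.pathAdj n) := by
    rw [SignedGraph.adjMatrix_partialTranspose, h₁]
    simp
  have hs₁ : SignedGraph.switchAt last 1 = (1 : Matrix (Fin n) (Fin n) ℝ) := by
    simp [SignedGraph.switchAt]
  refine ⟨SignedGraph.not_isomorphic_and_lapCospectral hn h_first h_last (ε := 1) (by norm_num)
    _ _ (by rw [h₁, hs₁, one_mul, mul_one]) (by rw [h₁', hs₁, one_mul, mul_one]),
    SignedGraph.not_isomorphic_and_lapCospectral hn h_first h_last (ε := -1) (by norm_num)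
    _ _ ?_ ?_⟩
  · rw [hΓ₂]
    ext (i | i) (j | j) <;>
      simp only [SignedGraph.adjMatrix_addEdge _ (show Sum.inl first ≠ Sum.inr first by simp),
        SignedGraph.adjMatrix_addEdge _ (show (Sum.inl penult : Fin n ⊕ Fin n) ≠ Sum.inl last by
          simpa using hpl), SignedGraph.adjMatrix_removeEdges, Set.mem_insert_iff,
        Set.mem_singleton_iff, Sym2.eq_iff, h₁, hs, fromBlocks_apply₁₁, fromBlocks_apply₁₂,
        fromBlocks_apply₂₁, fromBlocks_apply₂₂, Matrix.add_apply, Matrix.sub_apply, single_apply,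
        Sum.inl.injEq, Sum.inr.injEq, reduceCtorEq, Units.val_neg, Units.val_one, Int.cast_neg,
        Int.cast_one] <;>
      grind
  · rw [hΓ₃]
    ext (i | i) (j | j) <;>
      simp only [SignedGraph.adjMatrix_addEdge _ (show (Sum.inl penult : Fin n ⊕ Fin n) ≠
          Sum.inl last by simpa using hpl), SignedGraph.adjMatrix_removeEdges,
        Set.mem_singleton_iff, Sym2.eq_iff, h₁', hs, fromBlocks_apply₁₁, fromBlocks_apply₁₂,
        fromBlocks_apply₂₁, fromBlocks_apply₂₂, Matrix.add_apply, Matrix.sub_apply, single_apply,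
        Sum.inl.injEq, reduceCtorEq, Units.val_neg, Units.val_one, Int.cast_neg,
        Int.cast_one] <;>
      grind
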